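/- Let $G$ be a finite simple graph with vertex set $V=\{x_1,\dots,x_n\}$, let $k$ be a field and $R=k[x_1,\dots,x_n]$, and let $$J=\Big(\prod_{x\in W}x \;\Big|\; W\subseteq V \text{ is a vertex cover of } G\Big)\subseteq R$$ be the cover ideal of $G$, where a vertex cover is a set $W\subseteq V$ meeting every edge of $G$. Let $\chi$ denote the chromatic number and $\omega$ the size of a largest clique, and suppose that $G$ is perfect, that is, $\chi(G_S)=\omega(G_S)$ for every induced subgraph $G_S$, $S\subseteq V$. Write $\operatorname{Ass}(R/J^s)$ for the set of associated primes of the $R$-module $R/J^s$. Then 1. $\operatorname{Ass}(R/J^s)\subseteq \operatorname{Ass}(R/J^{s+1})$ for all integers $s\ge 1$; 2. $\displaystyle\bigcup_{s=1}^{\infty}\operatorname{Ass}(R/J^s)=\bigcup_{s=1}^{\chi(G)-1}\operatorname{Ass}(R/J^s)$ (the right-hand side is empty when $\chi(G)\le 1$). -/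

import Mathlib

/-- A (finite) graph `G` is perfect if `χ(G_S) = ω(G_S)` for every induced subgraph `G_S`,
`S ⊆ V`. -/
def SimpleGraph.IsPerfect {V : Type*} (G : SimpleGraph V) : Prop :=
  ∀ S : Set V, (G.induce S).chromaticNumber = ((G.induce S).cliqueNum : ℕ∞)

/-- The cover ideal of `G` in the polynomial ring over `k` whose variables are the vertices of `G`:
the ideal generated by the monomials `∏ x ∈ W, x`, where `W` runs over the vertex covers of `G`. -/
noncomputable def SimpleGraph.coverIdeal (k : Type*) [Field k] {V : Type*} (G : SimpleGraph V) :
    Ideal (MvPolynomial V k) :=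
  Ideal.span {m | ∃ W : Finset V, G.IsVertexCover (W : Set V) ∧ m = ∏ x ∈ W, MvPolynomial.X x}

/-- `G.assCoverPow k s` is the set `Ass(R/J^s)` of associated primes of the `R`-module `R/J^s`,
where `R = k[V]` and `J` is the cover ideal of `G`. -/
def SimpleGraph.assCoverPow (k : Type*) [Field k] {V : Type*} (G : SimpleGraph V) (s : ℕ) :
    Set (Ideal (MvPolynomial V k)) :=
  associatedPrimes (MvPolynomial V k) (MvPolynomial V k ⧸ (G.coverIdeal k) ^ s)

/-! For a clique `K`, let `P_K` be the prime generated by its variables. Perfection makes `J^s` the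
intersection of the powers `P_K^(s(|K|-1))` over cliques with `2 ≤ |K| ≤ s+1` (`coverIdeal_pow_eq`).
These powers are primary, and each component has a witness, so the associated primes are exactly
these `P_K`. The bound `|K| ≤ s+1` grows with `s`, and `|K| ≤ χ(G)`, which gives both claims. The
hard inclusion is combinatorial: `x^a` lies in `J^s` once `s` independent sets cover each `v` at
least `s - a v` times, since their complements are vertex covers. Such sets exist by a weighted form
of perfection, in the spirit of Lovász replication. -/

/-- A perfect graph has enough independent sets to cover any vertex weight `w`: `s` of them suffice
as soon as no clique has weight larger than `s`. -/
theorem SimpleGraph.IsPerfect.exists_isIndepSet_cover {V : Type*} [Fintype V] [DecidableEq V]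
    {G : SimpleGraph V} (hG : G.IsPerfect) (w : V → ℕ) (s : ℕ)
    (hw : ∀ K : Finset V, G.IsClique (K : Set V) → ∑ v ∈ K, w v ≤ s) :
    ∃ I : Fin s → Finset V, (∀ i, G.IsIndepSet (I i : Set V)) ∧
      ∀ v, w v ≤ (Finset.univ.filter fun i => v ∈ I i).card := by
  induction hn : ∑ v, w v using Nat.strong_induction_on generalizing w s with
  | _ n ih =>
  -- For 0/1 weights, the colour classes of the subgraph induced on weight 1 suffice.
  by_cases h1 : ∀ v, w v ≤ 1
  · set S : Set V := {v | w v = 1} with hS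
    have hcl : (G.induce S).cliqueNum ≤ s := by
      obtain ⟨t, ht⟩ := (G.induce S).exists_isNClique_cliqueNum
      have hc : G.IsClique ((t.map (Function.Embedding.subtype (· ∈ S)) : Finset V) : Set V) := by
        intro a ha b hb hab
        simp only [Finset.coe_map, Set.mem_image, Finset.mem_coe] at ha hb
        obtain ⟨a, ha, rfl⟩ := ha
        obtain ⟨b, hb, rfl⟩ := hb
        exact ht.isClique ha hb (fun h => hab (by rw [h]))
      have := hw _ hc
      rw [Finset.sum_map, Finset.sum_congr rfl (g := fun _ => 1) (fun x _ => x.2)] at this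
      simpa [ht.card_eq] using this
    have hcol : (G.induce S).Colorable s := by
      rw [← SimpleGraph.chromaticNumber_le_iff_colorable, hG S]
      exact_mod_cast hcl
    obtain ⟨C⟩ := hcol
    refine ⟨fun i => Finset.univ.filter fun v => ∃ h : v ∈ S, C ⟨v, h⟩ = i, ?_, ?_⟩
    · intro i a ha b hb _ hadj
      simp only [Finset.coe_filter, Finset.mem_univ, true_and, Set.mem_ofPred_eq] at ha hb
      obtain ⟨ha, rfl⟩ := ha
      obtain ⟨hb, hab⟩ := hb
      exact C.valid (v := ⟨a, ha⟩) (w := ⟨b, hb⟩) hadj hab.symm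
    · intro v
      by_cases hv : v ∈ S
      · refine (h1 v).trans (Finset.card_pos.2 ⟨C ⟨v, hv⟩, ?_⟩)
        simp [hv]
      · have : w v = 0 := by
          have := h1 v
          simp only [hS, Set.mem_ofPred_eq] at hv
          omega
        omega
  · push Not at h1
    obtain ⟨v, hv⟩ := h1
    -- Lower a weight that is at least 2: `v` remains covered, so some `I i` contains it. Removing
    -- this `I i` from `w` will lower the clique bound by one.
    have hle : ∀ u, (w - Pi.single v 1 : V → ℕ) u ≤ w u := fun u => Nat.sub_le _ _
    have hlt : ∑ u, (w - Pi.single v 1 : V → ℕ) u < ∑ u, w u :=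
      Finset.sum_lt_sum (fun u _ => hle u) ⟨v, Finset.mem_univ v, by simp; omega⟩
    obtain ⟨I, hI, hIw⟩ := ih _ (hn ▸ hlt) (w - Pi.single v 1) s
      (fun K hK => (Finset.sum_le_sum fun u _ => hle u).trans (hw K hK)) rfl
    obtain ⟨i, hi⟩ : ∃ i, v ∈ I i := by
      have h := hIw v
      simp only [Pi.sub_apply, Pi.single_eq_same] at h
      obtain ⟨i, hi⟩ := Finset.card_pos.1 (lt_of_lt_of_le (by omega) h)
      exact ⟨i, (Finset.mem_filter.1 hi).2⟩
    obtain ⟨m, rfl⟩ : ∃ m, s = m + 1 := ⟨s - 1, by have := i.2; omega⟩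
    set w' : V → ℕ := fun u => w u - if u ∈ I i then 1 else 0 with hw'
    have hle' : ∀ u, w' u ≤ w u := fun u => Nat.sub_le _ _
    have hlt' : ∑ u, w' u < ∑ u, w u :=
      Finset.sum_lt_sum (fun u _ => hle' u) ⟨v, Finset.mem_univ v, by simp [hw', hi]; omega⟩
    -- A violating clique has weight exactly `m + 1`, loses nothing to `I i`, and so avoids `v`.
    -- Covering it then forces each of the `m + 1` sets to meet it exactly once; the vertex in `I i`
    -- has positive weight and does lose 1.
    have hcl : ∀ K : Finset V, G.IsClique (K : Set V) → ∑ u ∈ K, w' u ≤ m := by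
      intro K hK
      by_contra! hlt
      have hKw := hw K hK
      have hww : ∑ u ∈ K, w u = ∑ u ∈ K, w' u :=
        le_antisymm (by omega) (Finset.sum_le_sum fun u _ => hle' u)
      have heq : ∀ u ∈ K, w' u = w u :=
        (Finset.sum_eq_sum_iff_of_le fun u _ => hle' u).1 hww.symm
      have hvK : v ∉ K := fun h => by
        have := heq v h
        simp only [hw', hi, if_true] at this
        omega
      have hsub : ∑ u ∈ K, w u ≤ ∑ u ∈ K, (Finset.univ.filter fun i => u ∈ I i).card := by
        refine Finset.sum_le_sum fun u hu => ?_
        have := hIw u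
        have huv : u ≠ v := fun h => hvK (h ▸ hu)
        simpa [huv] using this
      have hone : ∀ j, (K.filter fun u => u ∈ I j).card ≤ 1 := by
        intro j
        refine Finset.card_le_one.2 fun a ha b hb => ?_
        simp only [Finset.mem_filter] at ha hb
        by_contra hab
        exact hI j ha.2 hb.2 hab (hK ha.1 hb.1 hab)
      have hcomm : ∑ u ∈ K, (Finset.univ.filter fun i => u ∈ I i).card
          = ∑ j, (K.filter fun u => u ∈ I j).card := by
        simp only [Finset.card_filter]
        exact Finset.sum_comm
      have hle1 : ∑ j, (K.filter fun u => u ∈ I j).card ≤ ∑ _j : Fin (m + 1), 1 :=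
        Finset.sum_le_sum fun j _ => hone j
      have hcard : ∑ _j : Fin (m + 1), 1 = m + 1 := by simp
      have hall := (Finset.sum_eq_sum_iff_of_le fun j _ => hone j).1
        (le_antisymm hle1 (by omega)) i (Finset.mem_univ i)
      obtain ⟨u, hu⟩ := Finset.card_pos.1 (by omega : 0 < (K.filter fun u => u ∈ I i).card)
      rw [Finset.mem_filter] at hu
      have hpos : ∀ u ∈ K, w u = (Finset.univ.filter fun i => u ∈ I i).card := by
        refine (Finset.sum_eq_sum_iff_of_le fun u hu => ?_).1 (by omega)
        have huv : u ≠ v := fun h => hvK (h ▸ hu)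
        simpa [huv] using hIw u
      have h0 : 0 < (Finset.univ.filter fun i => u ∈ I i).card :=
        Finset.card_pos.2 ⟨i, by simp [hu.2]⟩
      have := heq u hu.1
      have := hpos u hu.1
      simp only [hw', hu.2, if_true] at *
      omega
    obtain ⟨I', hI', hIw'⟩ := ih _ (hn ▸ hlt') w' m hcl rfl
    refine ⟨Fin.cons (I i) I', Fin.cases (by simpa using hI i) (by simpa using hI'), fun u => ?_⟩
    have := hIw' u
    rw [Finset.card_filter] at this ⊢
    rw [Fin.sum_univ_succ]
    simp only [Fin.cons_zero, Fin.cons_succ]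
    simp only [hw'] at this
    omega

open MvPolynomial

/-! ### Powers of monomial primes, via the degree in the variables of `K` -/

section CliqueWeight

variable {k V : Type*} [Field k]

open Classical in
/-- The substitution `x ↦ T x` for `x ∈ K` and `x ↦ x` otherwise. -/
noncomputable def weightShift (k : Type*) [Field k] {V : Type*} (K : Finset V) :
    MvPolynomial V k →+* Polynomial (MvPolynomial V k) :=
  eval₂Hom (Polynomial.C.comp C)
    (fun v => Polynomial.C (X v) * Polynomial.X ^ (if v ∈ K then 1 else 0))

theorem weightShift_monomial (K : Finset V) (a : V →₀ ℕ) (c : k) :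
    weightShift k K (monomial a c) = Polynomial.C (monomial a c) * Polynomial.X ^ (∑ v ∈ K, a v) := by
  classical
  have h : a.sum (fun v e => (if v ∈ K then 1 else 0) * e) = ∑ v ∈ K, a v := by
    simp only [Finsupp.sum, ite_mul, one_mul, zero_mul, Finset.sum_ite_mem]
    refine Finset.sum_subset Finset.inter_subset_right fun v hv hva => ?_
    simpa [hv] using hva
  rw [weightShift, coe_eval₂Hom, eval₂_monomial, ← h, monomial_eq]
  simp only [mul_pow, ← pow_mul, RingHom.comp_apply, map_mul, Finsupp.prod, Finset.prod_mul_distrib,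
    Finset.prod_pow_eq_pow_sum, Finsupp.sum, map_prod, map_pow, mul_assoc]

theorem coeff_coeff_weightShift (K : Finset V) (f : MvPolynomial V k) (j : ℕ) (b : V →₀ ℕ) :
    ((weightShift k K f).coeff j).coeff b = if ∑ v ∈ K, b v = j then f.coeff b else 0 := by
  classical
  induction f using MvPolynomial.induction_on' with
  | monomial a c =>
    rw [weightShift_monomial, Polynomial.coeff_C_mul_X_pow]
    by_cases hab : a = b
    · subst hab
      simp only [eq_comm (a := j)]
      split_ifs <;> simp
    · split_ifs <;> simp [coeff_monomial, hab]
  | add p q hp hq =>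
    simp only [map_add, Polynomial.coeff_add, MvPolynomial.coeff_add, hp, hq]
    split_ifs <;> simp

/-- The ideal spanned by the monomials of degree at least `n` in the variables of `K`. -/
noncomputable def cliquePow (k : Type*) [Field k] {V : Type*} (K : Finset V) (n : ℕ) :
    Ideal (MvPolynomial V k) :=
  (Ideal.span {Polynomial.X ^ n}).comap (weightShift k K)

theorem mem_cliquePow {K : Finset V} {n : ℕ} {f : MvPolynomial V k} :
    f ∈ cliquePow k K n ↔ ∀ a ∈ f.support, n ≤ ∑ v ∈ K, a v := by
  rw [cliquePow, Ideal.mem_comap, Ideal.mem_span_singleton, Polynomial.X_pow_dvd_iff]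
  constructor
  · intro h a ha
    by_contra! hlt
    have := congrArg (MvPolynomial.coeff a) (h _ hlt)
    rw [coeff_coeff_weightShift, if_pos rfl] at this
    exact (mem_support_iff.1 ha) this
  · intro h j hj
    ext b
    rw [coeff_coeff_weightShift, coeff_zero]
    split_ifs with hb
    · by_contra hne
      have := h b (mem_support_iff.2 hne)
      omega
    · rfl

theorem monomial_mem_cliquePow {K : Finset V} {n : ℕ} {a : V →₀ ℕ} :
    monomial a (1 : k) ∈ cliquePow k K n ↔ n ≤ ∑ v ∈ K, a v := by
  classical
  rw [mem_cliquePow, support_monomial, if_neg one_ne_zero]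
  simp

theorem cliquePow_pow_le (K : Finset V) (n s : ℕ) :
    cliquePow k K n ^ s ≤ cliquePow k K (s * n) := by
  rw [cliquePow, cliquePow, mul_comm s n, pow_mul, ←
    Ideal.span_singleton_pow ((Polynomial.X : Polynomial (MvPolynomial V k)) ^ n) s]
  exact Ideal.le_comap_pow (weightShift k K) s

theorem cliquePow_one_isPrime (K : Finset V) : (cliquePow k K 1).IsPrime := by
  have : (Ideal.span {(Polynomial.X ^ 1 : Polynomial (MvPolynomial V k))}).IsPrime := by
    rw [pow_one]
    exact (Ideal.span_singleton_prime Polynomial.X_ne_zero).2 Polynomial.prime_X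
  exact Ideal.IsPrime.comap _

/-- This is primariness: it pulls back from the primality of `T` in the polynomial ring. -/
theorem mem_cliquePow_of_mul_mem {K : Finset V} {n : ℕ} {f g : MvPolynomial V k}
    (hg : g ∉ cliquePow k K 1) (h : g * f ∈ cliquePow k K n) : f ∈ cliquePow k K n := by
  rw [cliquePow, Ideal.mem_comap, Ideal.mem_span_singleton] at *
  rw [pow_one] at hg
  rw [map_mul] at h
  exact Polynomial.prime_X.pow_dvd_of_dvd_mul_left n hg h

theorem pow_mem_cliquePow {K : Finset V} {f : MvPolynomial V k} (hf : f ∈ cliquePow k K 1) (n : ℕ) :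
    f ^ n ∈ cliquePow k K n := by
  simpa using cliquePow_pow_le K 1 n (Ideal.pow_mem_pow hf n)

end CliqueWeight

/-! ### Decomposition of the powers of the cover ideal -/

namespace SimpleGraph

variable {k V : Type*} [Field k] {G : SimpleGraph V}

/-- A vertex cover misses at most one vertex of a clique. -/
theorem coverIdeal_le_cliquePow {K : Finset V} (hK : G.IsClique (K : Set V)) :
    G.coverIdeal k ≤ cliquePow k K (K.card - 1) := by
  classical
  refine Ideal.span_le.2 ?_
  rintro _ ⟨W, hW, rfl⟩
  have : ∏ x ∈ W, (X x : MvPolynomial V k) = monomial (∑ x ∈ W, Finsupp.single x 1) 1 := by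
    rw [monomial_sum_one]
    rfl
  rw [this, SetLike.mem_coe, monomial_mem_cliquePow]
  have h1 : (K \ W).card ≤ 1 := by
    refine Finset.card_le_one.2 fun a ha b hb => ?_
    rw [Finset.mem_sdiff] at ha hb
    by_contra hab
    rcases hW (hK ha.1 hb.1 hab) with h | h
    exacts [ha.2 h, hb.2 h]
  have h2 : ∑ v ∈ K, (∑ x ∈ W, Finsupp.single x 1) v = (K ∩ W).card := by
    simp [Finsupp.finsetSum_apply, Finsupp.single_apply, Finset.sum_ite_mem]
  have := Finset.card_sdiff_add_card_inter K W
  omega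

/-- The cliques whose prime ideals are associated to the `s`-th power of the cover ideal. -/
noncomputable def smallCliques (G : SimpleGraph V) [Fintype V] (s : ℕ) : Finset (Finset V) :=
  open Classical in
  Finset.univ.filter fun K => G.IsClique (K : Set V) ∧ 2 ≤ K.card ∧ K.card ≤ s + 1

theorem mem_smallCliques [Fintype V] {s : ℕ} {K : Finset V} :
    K ∈ G.smallCliques s ↔ G.IsClique (K : Set V) ∧ 2 ≤ K.card ∧ K.card ≤ s + 1 := by
  simp [smallCliques]

/-- In a minimal violating clique every deficit `s - a v` is positive, and deleting a vertex leaves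
total at most `s`; hence `|K| ≤ s+1`. No subtraction truncates there, so the hypothesis on `K`
applies directly. -/
theorem sum_sub_le_of_smallCliques [Fintype V] {s : ℕ} {a : V → ℕ}
    (ha : ∀ K ∈ G.smallCliques s, s * (K.card - 1) ≤ ∑ v ∈ K, a v) (K : Finset V)
    (hK : G.IsClique (K : Set V)) : ∑ v ∈ K, (s - a v) ≤ s := by
  classical
  induction hn : K.card using Nat.strong_induction_on generalizing K with
  | _ n ih =>
  have herase : ∀ v ∈ K, ∑ u ∈ K.erase v, (s - a u) ≤ s := fun v hv =>
    ih _ (hn ▸ Finset.card_erase_lt_of_mem hv) _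
      (hK.subset (by simp)) rfl
  by_contra! hlt
  have hpos : ∀ v ∈ K, 1 ≤ s - a v := fun v hv => by
    have := herase v hv
    have := Finset.sum_erase_add K (fun u => s - a u) hv
    omega
  have h2 : 2 ≤ K.card := by
    by_contra! h
    have : ∑ v ∈ K, (s - a v) ≤ K.card • s := Finset.sum_le_card_nsmul _ _ _ fun v _ => by omega
    have : K.card • s ≤ 1 • s := Nat.mul_le_mul_right s (by omega)
    simp only [one_smul] at this
    omega
  have h3 : K.card ≤ s + 1 := by
    obtain ⟨v, hv⟩ := Finset.card_pos.1 (by omega : 0 < K.card)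
    have h4 : (K.erase v).card • 1 ≤ ∑ u ∈ K.erase v, (s - a u) :=
      Finset.card_nsmul_le_sum _ _ _ fun u hu => hpos u (Finset.mem_of_mem_erase hu)
    have := herase v hv
    rw [Finset.card_erase_of_mem hv, smul_eq_mul, mul_one] at h4
    omega
  have h5 := ha K (mem_smallCliques.2 ⟨hK, h2, h3⟩)
  have h6 : ∑ v ∈ K, (s - a v) + ∑ v ∈ K, a v = K.card * s := by
    rw [← Finset.sum_add_distrib, Finset.sum_congr rfl (g := fun _ => s), Finset.sum_const,
      smul_eq_mul]
    intro v hv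
    have := hpos v hv
    omega
  obtain ⟨m, hm⟩ : ∃ m, K.card = m + 1 := ⟨K.card - 1, by omega⟩
  rw [hm] at h5 h6
  simp only [Nat.add_sub_cancel] at h5
  have : (m + 1) * s = s * m + s := by ring
  omega

theorem prod_X_mem_coverIdeal [Fintype V] [DecidableEq V] {I : Finset V}
    (hI : G.IsIndepSet (I : Set V)) : ∏ x ∈ Iᶜ, X x ∈ G.coverIdeal k := by
  refine Ideal.subset_span ⟨Iᶜ, ?_, rfl⟩
  rw [Finset.coe_compl]
  exact isVertexCover_compl.2 hI

theorem IsPerfect.monomial_mem_coverIdeal_pow [Fintype V] (hG : G.IsPerfect) {s : ℕ} {a : V →₀ ℕ}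
    (ha : ∀ K ∈ G.smallCliques s, s * (K.card - 1) ≤ ∑ v ∈ K, a v) (c : k) :
    monomial a c ∈ G.coverIdeal k ^ s := by
  classical
  obtain ⟨I, hI, hIw⟩ := hG.exists_isIndepSet_cover (fun v => s - a v) s
    (sum_sub_le_of_smallCliques ha)
  have hmem : ∏ i : Fin s, ∏ x ∈ (I i)ᶜ, (X x : MvPolynomial V k) ∈ G.coverIdeal k ^ s := by
    have := Ideal.prod_mem_prod (s := Finset.univ) (I := fun _ : Fin s => G.coverIdeal k)
      fun i _ => prod_X_mem_coverIdeal (k := k) (hI i)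
    simpa using this
  have hmon : ∏ i : Fin s, ∏ x ∈ (I i)ᶜ, (X x : MvPolynomial V k)
      = monomial (∑ i : Fin s, ∑ x ∈ (I i)ᶜ, Finsupp.single x 1) 1 := by
    simp only [monomial_sum_one]
    rfl
  rw [hmon] at hmem
  refine Ideal.mem_of_dvd _ ((monomial_dvd_monomial).2 ⟨Or.inr ?_, one_dvd c⟩) hmem
  intro v
  have h1 := hIw v
  have h2 : (∑ i : Fin s, ∑ x ∈ (I i)ᶜ, Finsupp.single x 1) v
      = (Finset.univ.filter fun i => v ∉ I i).card := by
    simp [Finsupp.finsetSum_apply, Finsupp.single_apply, Finset.card_filter]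
  have h3 := Finset.card_filter_add_card_filter_not (s := (Finset.univ : Finset (Fin s)))
    (fun i => v ∈ I i)
  rw [Finset.card_univ, Fintype.card_fin] at h3
  rw [h2]
  omega

theorem IsPerfect.coverIdeal_pow_eq [Fintype V] (hG : G.IsPerfect) (s : ℕ) :
    G.coverIdeal k ^ s = (G.smallCliques s).inf fun K => cliquePow k K (s * (K.card - 1)) := by
  refine le_antisymm (Finset.le_inf fun K hK => ?_) fun f hf => ?_
  · exact (Ideal.pow_right_mono (coverIdeal_le_cliquePow (mem_smallCliques.1 hK).1) s).trans
      (cliquePow_pow_le K _ s)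
  · rw [Submodule.mem_finsetInf] at hf
    rw [f.as_sum]
    exact Ideal.sum_mem _ fun a ha => hG.monomial_mem_coverIdeal_pow
      (fun K hK => mem_cliquePow.1 (hf K hK) a ha) _

/-! ### Associated primes -/

theorem mem_assCoverPow_iff [Finite V] {s : ℕ} {P : Ideal (MvPolynomial V k)} :
    P ∈ G.assCoverPow k s ↔ P.IsPrime ∧ ∃ f, ∀ g, g ∈ P ↔ g * f ∈ G.coverIdeal k ^ s := by
  rw [assCoverPow, AssociatedPrimes.mem_iff, isAssociatedPrime_iff]
  refine and_congr_right fun _ => ?_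
  rw [(Ideal.Quotient.mk_surjective).exists]
  refine exists_congr fun f => ?_
  rw [Ideal.ext_iff]
  refine forall_congr' fun g => ?_
  rw [Submodule.mem_colon_singleton, Submodule.mem_bot, ← Ideal.Quotient.eq_zero_iff_mem (I := G.coverIdeal k ^ s),
    map_mul]
  rfl

/-- The associated primes of the powers of the cover ideal of a perfect graph are the primes of
cliques of bounded size. -/
theorem IsPerfect.mem_assCoverPow_iff [Fintype V] (hG : G.IsPerfect) {s : ℕ}
    {P : Ideal (MvPolynomial V k)} :
    P ∈ G.assCoverPow k s ↔ ∃ K ∈ G.smallCliques s, P = cliquePow k K 1 := by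
  classical
  rw [SimpleGraph.mem_assCoverPow_iff]
  constructor
  · rintro ⟨hP, f, hf⟩
    have hcol : ∀ g, g ∈ P ↔ ∀ K ∈ G.smallCliques s, g * f ∈ cliquePow k K (s * (K.card - 1)) := by
      intro g
      rw [hf, hG.coverIdeal_pow_eq, Submodule.mem_finsetInf]
    let Q : Finset V → Ideal (MvPolynomial V k) := fun K =>
      Submodule.colon (cliquePow k K (s * (K.card - 1))) {f}
    have hQ : ∀ K g, g ∈ Q K ↔ g * f ∈ cliquePow k K (s * (K.card - 1)) := fun K g => by
      simp only [Q, Submodule.mem_colon_singleton, smul_eq_mul]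
    have hle : (G.smallCliques s).inf Q ≤ P := fun g hg => by
      rw [Submodule.mem_finsetInf] at hg
      exact (hcol g).2 fun K hK => (hQ K g).1 (hg K hK)
    -- A prime containing a finite intersection of colon ideals contains one of them; primariness of
    -- that component identifies the prime.
    obtain ⟨K, hK, hKP⟩ := hP.inf_le'.1 hle
    refine ⟨K, hK, le_antisymm (fun g hg => ?_) fun g hg => ?_⟩
    · by_contra hgK
      have hfK := mem_cliquePow_of_mul_mem hgK ((hcol g).1 hg K hK)
      exact hP.ne_top ((Ideal.eq_top_iff_one P).2 (hKP ((hQ K 1).2 (by simpa using hfK))))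
    · exact hP.mem_of_pow_mem (s * (K.card - 1))
        (hKP ((hQ K _).2 (Ideal.mul_mem_right _ _ (pow_mem_cliquePow hg _))))
  · rintro ⟨K, hK, rfl⟩
    refine ⟨cliquePow_one_isPrime K, ?_⟩
    obtain ⟨hKc, hK2, hKs⟩ := mem_smallCliques.1 hK
    obtain ⟨u, hu⟩ := Finset.card_pos.1 (by omega : 0 < K.card)
    -- The `K`-degree of this exponent is one short of `s(|K|-1)`, which forces the value `|K|-2` at
    -- `u`. On `K` all exponents are below `s` (this uses `|K| ≤ s+1`), so the deficits there total
    -- `s+1` and any variable of `K` reduces them; outside `K` there is no deficit.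
    let a : V →₀ ℕ := Finsupp.equivFunOnFinite.symm fun v =>
      if v = u then K.card - 2 else if v ∈ K then s - 1 else s
    have hau : a u = K.card - 2 := by simp [a]
    have haK : ∀ v ∈ K, v ≠ u → a v = s - 1 := fun v hv hvu => by simp [a, hv, hvu]
    have hav : ∀ v, v ∉ K → a v = s := fun v hv => by
      have : v ≠ u := fun h => hv (h ▸ hu)
      simp [a, hv, this]
    have hsum : ∑ v ∈ K, a v + 1 = s * (K.card - 1) := by
      rw [← Finset.add_sum_erase K _ hu, hau, Finset.sum_congr rfl (g := fun _ => s - 1)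
        (fun v hv => haK v (Finset.mem_of_mem_erase hv) (Finset.ne_of_mem_erase hv)),
        Finset.sum_const, Finset.card_erase_of_mem hu, smul_eq_mul]
      obtain ⟨m, hm⟩ : ∃ m, K.card = m + 2 := ⟨K.card - 2, by omega⟩
      obtain ⟨t, rfl⟩ : ∃ t, s = t + 1 := ⟨s - 1, by omega⟩
      rw [hm]
      simp only [Nat.add_sub_cancel, show m + 2 - 1 = m + 1 by omega]
      ring
    refine ⟨monomial a 1, fun g => ⟨fun hg => ?_, fun hg => ?_⟩⟩
    · rw [g.as_sum, Finset.sum_mul]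
      refine Ideal.sum_mem _ fun b hb => ?_
      rw [monomial_mul]
      refine hG.monomial_mem_coverIdeal_pow (fun L hL => ?_) _
      have hbK := mem_cliquePow.1 hg b hb
      obtain ⟨z, hzK, hz⟩ : ∃ z ∈ K, 0 < b z := by
        by_contra! h
        have := Finset.sum_nonpos h
        omega
      have halt : ∀ v ∈ K, a v < s := fun v hv => by
        by_cases hvu : v = u
        · rw [hvu, hau]
          omega
        · rw [haK v hv hvu]
          omega
      have h1 : ∑ v ∈ K, (s - (b + a) v) < ∑ v ∈ K, (s - a v) := by
        refine Finset.sum_lt_sum (fun v _ => ?_) ⟨z, hzK, ?_⟩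
        · rw [Finsupp.add_apply]
          omega
        · have := halt z hzK
          rw [Finsupp.add_apply]
          omega
      have h2 : ∑ v ∈ K, (s - a v) + ∑ v ∈ K, a v = K.card * s := by
        rw [← Finset.sum_add_distrib, Finset.sum_congr rfl (g := fun _ => s), Finset.sum_const,
          smul_eq_mul]
        intro v hv
        have := halt v hv
        omega
      have h3 : K.card * s = s * (K.card - 1) + s := by
        rw [mul_comm, ← Nat.mul_succ]
        congr 1
        omega
      -- All deficit sits in `K`, so the bound for `K` controls every other clique `L`.
      have h4 : ∑ v ∈ L, (s - (b + a) v) ≤ ∑ v ∈ K, (s - (b + a) v) := by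
        refine Finset.sum_le_sum_of_ne_zero fun v _ hv => ?_
        by_contra hvK
        rw [Finsupp.add_apply, hav v hvK] at hv
        omega
      have h5 : L.card • s ≤ ∑ v ∈ L, (s - (b + a) v + (b + a) v) :=
        Finset.card_nsmul_le_sum _ _ _ fun v _ => by omega
      rw [Finset.sum_add_distrib, smul_eq_mul, mul_comm] at h5
      rw [Nat.mul_sub_one]
      omega
    · by_contra hgK
      rw [hG.coverIdeal_pow_eq, Submodule.mem_finsetInf] at hg
      have := monomial_mem_cliquePow.1 (mem_cliquePow_of_mul_mem hgK (hg K hK))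
      omega

end SimpleGraph

theorem mainTheorem9 {k : Type*} [Field k] {V : Type*} [Finite V] (G : SimpleGraph V)
    (hG : G.IsPerfect) :
    (∀ s : ℕ, 1 ≤ s → G.assCoverPow k s ⊆ G.assCoverPow k (s + 1)) ∧
    (⋃ s ∈ {s : ℕ | 1 ≤ s}, G.assCoverPow k s) =
      ⋃ s ∈ {s : ℕ | 1 ≤ s ∧ (s : ℕ∞) ≤ G.chromaticNumber - 1}, G.assCoverPow k s := by
  have := Fintype.ofFinite V
  refine ⟨fun s _ P hP => ?_, Set.Subset.antisymm (fun P hP => ?_) ?_⟩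
  · obtain ⟨K, hK, rfl⟩ := hG.mem_assCoverPow_iff.1 hP
    obtain ⟨h1, h2, h3⟩ := SimpleGraph.mem_smallCliques.1 hK
    exact hG.mem_assCoverPow_iff.2 ⟨K, SimpleGraph.mem_smallCliques.2 ⟨h1, h2, by omega⟩, rfl⟩
  · simp only [Set.mem_iUnion] at hP ⊢
    obtain ⟨s, _, hP⟩ := hP
    obtain ⟨K, hK, rfl⟩ := hG.mem_assCoverPow_iff.1 hP
    obtain ⟨h1, h2, -⟩ := SimpleGraph.mem_smallCliques.1 hK
    -- The power `|K|-1` is the first at which `K` counts as small, and it is at most `χ(G)-1`.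
    refine ⟨K.card - 1, ⟨by omega, ?_⟩, hG.mem_assCoverPow_iff.2
      ⟨K, SimpleGraph.mem_smallCliques.2 ⟨h1, h2, by omega⟩, rfl⟩⟩
    rw [ENat.natCast_sub, Nat.cast_one]
    exact tsub_le_tsub_right h1.card_le_chromaticNumber 1
  · exact Set.biUnion_subset_biUnion_left fun s hs => hs.1
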